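/- Work in the pure $\lambda$-calculus, $\Lambda$ being the set of all (not necessarily closed) $\lambda$-terms, with $\to_\beta$ denoting $\beta$-reduction in any finite number of steps (possibly none). Types of System $\mathcal F$ are built from countably many type variables by $\to$ and $\forall$, and $\Gamma\vdash_{\mathcal F} t:A$ is the usual Curry-style typability relation, given by the rules for variables, abstraction and application together with: from $\Gamma\vdash_{\mathcal F} t:A$ infer $\Gamma\vdash_{\mathcal F} t:\forall X A$ if $X$ is not free in $\Gamma$; from $\Gamma\vdash_{\mathcal F} t:\forall X A$ infer $\Gamma\vdash_{\mathcal F} t:A[C/X]$ for any type $C$. One step of weak head reduction replaces $(\lambda x\,u)\,v\,v_1\cdots v_m$ ($m\ge 0$) by $u[v/x]\,v_1\cdots v_m$; write $t\succ_f u$ if $u$ is obtained from $t$ by finitely many (possibly zero) such steps. A set $G\subseteq\Lambda$ is saturated if $u\in G$ and $t\succ_f u$ imply $t\in G$. An interpretation $I$ assigns to each type variable $X$ a saturated set $|X|_I$; it extends to types by $$|A\to B|_I=\{u\in\Lambda : (u)t\in|B|_I \text{ for all } t\in|A|_I\},\qquad |\forall X A|_I=\bigcap_{G\text{ saturated}}|A|_{I[X\leftarrow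 G]},$$ where $I[X\leftarrow G]$ maps $X$ to $G$ and agrees with $I$ on the other variables. Put $|A|=\bigcap_I|A|_I$, the intersection over all interpretations $I$. The $\forall^+$ types and the $\forall^-$ types are defined simultaneously as the least classes such that: every type variable is both $\forall^+$ and $\forall^-$; if $A$ is $\forall^+$ and $B$ is $\forall^-$, then $B\to A$ is $\forall^+$; if $A$ is $\forall^-$ and $B$ is $\forall^+$, then $B\to A$ is $\forall^-$; if $A$ is $\forall^+$ and $X$ is free in $A$, then $\forall X A$ is $\forall^+$. **Theorem.** Let $A$ be a $\forall^+$ type of System $\mathcal F$ and let $t$ be a $\lambda$-term. Then $t\in|A|$ if and only if there is a $\lambda$-term $t'$ such that $t\to_\beta t'$ and $\vdash_{\mathcal F}t':A$ (in the empty context). -/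

import Mathlib

namespace SystemF

/-- Pure lambda-terms (up to renaming of bound variables), in de Bruijn notation. The variables
are the natural numbers; a term need not be closed. -/
inductive Term : Type
  | var : ℕ → Term
  | app : Term → Term → Term
  | lam : Term → Term

/-- Lifting of a renaming of variables under a binder. -/
def liftRen (r : ℕ → ℕ) : ℕ → ℕ
  | 0 => 0
  | n + 1 => r n + 1

namespace Term

/-- Renaming of the free variables of a term. -/
def rename : (ℕ → ℕ) → Term → Term
  | r, var n => var (r n)
  | r, app t u => app (rename r t) (rename r u)
  | r, lam t => lam (rename (liftRen r) t)

/-- Lifting of a substitution under a binder. -/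
def liftSubst (s : ℕ → Term) : ℕ → Term
  | 0 => var 0
  | n + 1 => rename Nat.succ (s n)

/-- Simultaneous capture-avoiding substitution. -/
def subst : (ℕ → Term) → Term → Term
  | s, var n => s n
  | s, app t u => app (subst s t) (subst s u)
  | s, lam t => lam (subst (liftSubst s) t)

/-- The substitution which replaces variable `0` by `v` and lowers all other variables by one. -/
def single (v : Term) : ℕ → Term
  | 0 => v
  | n + 1 => var n

/-- For `lam u` standing for `λ x u`, the term `inst u v` is `u[v/x]`. -/
def inst (u v : Term) : Term := subst (single v) u

end Term

/-- One step of beta-reduction, in any position. -/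
inductive BetaStep : Term → Term → Prop
  | beta (u v : Term) : BetaStep (Term.app (Term.lam u) v) (Term.inst u v)
  | appL {t t' : Term} (u : Term) : BetaStep t t' → BetaStep (Term.app t u) (Term.app t' u)
  | appR (t : Term) {u u' : Term} : BetaStep u u' → BetaStep (Term.app t u) (Term.app t u')
  | lam {t t' : Term} : BetaStep t t' → BetaStep (Term.lam t) (Term.lam t')

/-- Beta-reduction `t →β t'` (any finite number of steps, possibly none). -/
def BetaRed : Term → Term → Prop := Relation.ReflTransGen BetaStep

/-- One step of weak head reduction:
`(λ x u) v v₁ ... vₘ` is replaced by `u[v/x] v₁ ... vₘ`. -/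
inductive WHStep : Term → Term → Prop
  | beta (u v : Term) : WHStep (Term.app (Term.lam u) v) (Term.inst u v)
  | appL {t t' : Term} (u : Term) : WHStep t t' → WHStep (Term.app t u) (Term.app t' u)

/-- Weak head reduction (any finite number of steps, possibly none). -/
def WHRed : Term → Term → Prop := Relation.ReflTransGen WHStep

/-- Types of System F (up to renaming of bound variables), in de Bruijn notation:
type variables, `A → B` and `∀ X A`. In `all A`, the variable `0` of `A` is the quantified one. -/
inductive Ty : Type
  | var : ℕ → Ty
  | arrow : Ty → Ty → Ty
  | all : Ty → Ty

namespace Ty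

/-- Renaming of the free type variables of a type. -/
def rename : (ℕ → ℕ) → Ty → Ty
  | r, var n => var (r n)
  | r, arrow A B => arrow (rename r A) (rename r B)
  | r, all A => all (rename (liftRen r) A)

/-- The same type, read in a scope with one more type variable, numbered `0`
(which is thus not free in it). -/
def shift (A : Ty) : Ty := rename Nat.succ A

/-- Lifting of a type substitution under a quantifier. -/
def liftSubst (s : ℕ → Ty) : ℕ → Ty
  | 0 => var 0
  | n + 1 => shift (s n)

/-- Simultaneous capture-avoiding substitution in types. -/
def subst : (ℕ → Ty) → Ty → Ty
  | s, var n => s n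
  | s, arrow A B => arrow (subst s A) (subst s B)
  | s, all A => all (subst (liftSubst s) A)

/-- The substitution which replaces variable `0` by `C` and lowers all other variables by one. -/
def single (C : Ty) : ℕ → Ty
  | 0 => C
  | n + 1 => var n

/-- For `all A` standing for `∀ X A`, the type `inst A C` is `A[C/X]`. -/
def inst (A C : Ty) : Ty := subst (single C) A

/-- The type variable `n` occurs free in a type. -/
def Free : ℕ → Ty → Prop
  | n, var m => n = m
  | n, arrow A B => Free n A ∨ Free n B
  | n, all A => Free (n + 1) A

end Ty

/-- Typing in System F (Curry style). A context is a list of types, whose `i`-th entry is the type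
declared for the term variable `i`. In `gen`, the hypothesis is read in a scope with a new type
variable `0`, which by the shift does not occur in the context. -/
inductive HasType : List Ty → Term → Ty → Prop
  | var {Γ : List Ty} {i : ℕ} {A : Ty} : Γ[i]? = some A → HasType Γ (Term.var i) A
  | lam {Γ : List Ty} {t : Term} {B C : Ty} :
      HasType (B :: Γ) t C → HasType Γ (Term.lam t) (Ty.arrow B C)
  | app {Γ : List Ty} {u v : Term} {B C : Ty} :
      HasType Γ u (Ty.arrow B C) → HasType Γ v B → HasType Γ (Term.app u v) C
  | gen {Γ : List Ty} {t : Term} {A : Ty} :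
      HasType (Γ.map Ty.shift) t A → HasType Γ t (Ty.all A)
  | inst {Γ : List Ty} {t : Term} {A : Ty} (C : Ty) :
      HasType Γ t (Ty.all A) → HasType Γ t (Ty.inst A C)

/-- A set of terms is saturated if it is closed under weak head expansion. -/
def Saturated (G : Set Term) : Prop :=
  ∀ t u : Term, u ∈ G → WHRed t u → t ∈ G

/-- `G → G'`, the set of all `u` with `(u)t ∈ G'` for every `t ∈ G`. -/
def arrowSet (G G' : Set Term) : Set Term :=
  {u | ∀ t ∈ G, Term.app u t ∈ G'}

/-- An interpretation maps each type variable to a saturated set of terms. -/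
abbrev Interp : Type := ℕ → {G : Set Term // Saturated G}

/-- The interpretation, in the scope with a new type variable `0`, which maps that variable to `G`
and agrees with `I` on the others. -/
def Interp.push (I : Interp) (G : {G : Set Term // Saturated G}) : Interp
  | 0 => G
  | n + 1 => I n

/-- The value `|A|_I` of a type in an interpretation. -/
def Ty.value : Interp → Ty → Set Term
  | I, Ty.var n => (I n).1
  | I, Ty.arrow A B => arrowSet (Ty.value I A) (Ty.value I B)
  | I, Ty.all A => ⋂ G : {G : Set Term // Saturated G}, Ty.value (I.push G) A

/-- `|A|`, the intersection of the values of `A` in all interpretations. -/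
def Ty.sem (A : Ty) : Set Term := ⋂ I : Interp, A.value I

mutual

/-- The types with positive quantifiers. -/
inductive IsPos : Ty → Prop
  | var (n : ℕ) : IsPos (Ty.var n)
  | arrow {B A : Ty} : IsNeg B → IsPos A → IsPos (Ty.arrow B A)
  | all {A : Ty} : IsPos A → Ty.Free 0 A → IsPos (Ty.all A)

/-- The types with negative quantifiers. -/
inductive IsNeg : Ty → Prop
  | var (n : ℕ) : IsNeg (Ty.var n)
  | arrow {B A : Ty} : IsPos B → IsNeg A → IsNeg (Ty.arrow B A)

end

end SystemF

namespace SystemF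

/-! ### Renaming and substitution in terms -/

theorem liftRen_comp (r r' : ℕ → ℕ) :
    (fun n => liftRen r' (liftRen r n)) = liftRen (fun n => r' (r n)) := by
  funext n; cases n <;> rfl

theorem liftRen_id : liftRen (fun n => n) = fun n => n := by
  funext n; cases n <;> rfl

namespace Term

theorem rename_rename (t : Term) (r r' : ℕ → ℕ) :
    rename r' (rename r t) = rename (fun n => r' (r n)) t := by
  induction t generalizing r r' with
  | var n => rfl
  | app t u iht ihu => simp [rename, iht, ihu]
  | lam t ih => simp [rename, ih, liftRen_comp]

theorem rename_id (t : Term) : rename (fun n => n) t = t := by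
  induction t with
  | var n => rfl
  | app t u iht ihu => simp [rename, iht, ihu]
  | lam t ih => simp [rename, liftRen_id, ih]

theorem subst_rename (t : Term) (r : ℕ → ℕ) (s : ℕ → Term) :
    subst s (rename r t) = subst (fun n => s (r n)) t := by
  induction t generalizing r s with
  | var n => rfl
  | app t u iht ihu => simp [rename, subst, iht, ihu]
  | lam t ih =>
    simp only [rename, subst, ih]
    congr 2
    funext n; cases n <;> rfl

theorem rename_subst (t : Term) (s : ℕ → Term) (r : ℕ → ℕ) :
    rename r (subst s t) = subst (fun n => rename r (s n)) t := by
  induction t generalizing r s with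
  | var n => rfl
  | app t u iht ihu => simp [rename, subst, iht, ihu]
  | lam t ih =>
    simp only [rename, subst, ih]
    congr 2
    funext n
    cases n with
    | zero => rfl
    | succ n => simp [liftSubst, rename_rename, liftRen]

theorem subst_subst (t : Term) (s s' : ℕ → Term) :
    subst s' (subst s t) = subst (fun n => subst s' (s n)) t := by
  induction t generalizing s s' with
  | var n => rfl
  | app t u iht ihu => simp [subst, iht, ihu]
  | lam t ih =>
    simp only [subst, ih]
    congr 2
    funext n
    cases n with
    | zero => rfl
    | succ n => simp [liftSubst, rename_subst, subst_rename]

theorem subst_var (t : Term) : subst var t = t := by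
  have h : liftSubst var = var := by funext n; cases n <;> rfl
  induction t with
  | var n => rfl
  | app t u iht ihu => simp [subst, iht, ihu]
  | lam t ih => simp [subst, h, ih]

theorem rename_inst (u v : Term) (r : ℕ → ℕ) :
    rename r (inst u v) = inst (rename (liftRen r) u) (rename r v) := by
  simp only [inst, rename_subst, subst_rename]
  congr 1
  funext n; cases n <;> rfl

theorem subst_inst (u v : Term) (s : ℕ → Term) :
    subst s (inst u v) = inst (subst (liftSubst s) u) (subst s v) := by
  simp only [inst, subst_subst]
  congr 1
  funext n
  cases n with
  | zero => rfl
  | succ n => simp [subst, single, liftSubst, subst_rename, subst_var]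

/-- The term variable `n` occurs free in a term. -/
def Free : ℕ → Term → Prop
  | n, var m => n = m
  | n, app t u => Free n t ∨ Free n u
  | n, lam t => Free (n + 1) t

theorem Free.of_rename {t : Term} {r : ℕ → ℕ} {y : ℕ} (h : Free y (rename r t)) :
    ∃ x, Free x t ∧ y = r x := by
  induction t generalizing r y with
  | var n => exact ⟨n, rfl, h⟩
  | app t u iht ihu =>
    rcases h with h | h
    · obtain ⟨x, hx, e⟩ := iht h; exact ⟨x, Or.inl hx, e⟩
    · obtain ⟨x, hx, e⟩ := ihu h; exact ⟨x, Or.inr hx, e⟩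
  | lam t ih =>
    obtain ⟨x, hx, e⟩ := ih h
    cases x with
    | zero => simp [liftRen] at e
    | succ x => exact ⟨x, hx, by simpa [liftRen] using e⟩

theorem Free.of_subst {t : Term} {s : ℕ → Term} {y : ℕ} (h : Free y (subst s t)) :
    ∃ x, Free x t ∧ Free y (s x) := by
  induction t generalizing s y with
  | var n => exact ⟨n, rfl, h⟩
  | app t u iht ihu =>
    rcases h with h | h
    · obtain ⟨x, hx, e⟩ := iht h; exact ⟨x, Or.inl hx, e⟩
    · obtain ⟨x, hx, e⟩ := ihu h; exact ⟨x, Or.inr hx, e⟩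
  | lam t ih =>
    obtain ⟨x, hx, e⟩ := ih h
    cases x with
    | zero => simp [liftSubst, Free] at e
    | succ x =>
      obtain ⟨z, hz, e'⟩ := Free.of_rename e
      obtain rfl : y = z := Nat.succ.inj e'
      exact ⟨x, hx, hz⟩

theorem Free.of_inst {u v : Term} {y : ℕ} (h : Free y (inst u v)) :
    Free y (app (lam u) v) := by
  obtain ⟨x, hx, hy⟩ := Free.of_subst h
  cases x with
  | zero => exact Or.inr hy
  | succ x =>
    obtain rfl : y = x := hy
    exact Or.inl hx

theorem exists_free_bound (t : Term) : ∃ N, ∀ x, Free x t → x < N := by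
  induction t with
  | var n => exact ⟨n + 1, fun x h => by obtain rfl : x = n := h; omega⟩
  | app t u iht ihu =>
    obtain ⟨a, ha⟩ := iht
    obtain ⟨b, hb⟩ := ihu
    refine ⟨max a b, fun x h => ?_⟩
    rcases h with h | h
    · exact lt_max_of_lt_left (ha x h)
    · exact lt_max_of_lt_right (hb x h)
  | lam t ih =>
    obtain ⟨a, ha⟩ := ih
    exact ⟨a, fun x h => by have := ha _ h; omega⟩

theorem rename_congr_of_free {t : Term} {r r' : ℕ → ℕ} (h : ∀ x, Free x t → r x = r' x) :
    rename r t = rename r' t := by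
  induction t generalizing r r' with
  | var n => simp [rename, h n rfl]
  | app t u iht ihu =>
    simp only [rename]
    rw [iht fun x hx => h x (Or.inl hx), ihu fun x hx => h x (Or.inr hx)]
  | lam t ih =>
    simp only [rename]
    rw [ih (r' := liftRen r')]
    intro x hx
    cases x with
    | zero => rfl
    | succ x => simp [liftRen, h x hx]

/-- The term `(t) x` for a new variable `x`, numbered `0`. -/
def etaApp (t : Term) : Term := app (rename Nat.succ t) (var 0)

theorem rename_etaApp (t : Term) (r : ℕ → ℕ) :
    rename (liftRen r) (etaApp t) = etaApp (rename r t) := by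
  simp [etaApp, rename, rename_rename, liftRen]

theorem Free.of_etaApp {t : Term} {y : ℕ} (h : Free y (etaApp t)) :
    y = 0 ∨ ∃ x, y = x + 1 ∧ Free x t := by
  rcases h with h | h
  · obtain ⟨x, hx, e⟩ := Free.of_rename h
    exact Or.inr ⟨x, e, hx⟩
  · exact Or.inl h

/-- The substitution which replaces variable `0` by `v` and the variable `n + 1` by `s n`. -/
def scons (v : Term) (s : ℕ → Term) : ℕ → Term
  | 0 => v
  | n + 1 => s n

theorem inst_subst_liftSubst (t v : Term) (s : ℕ → Term) :
    inst (subst (liftSubst s) t) v = subst (scons v s) t := by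
  simp only [inst, subst_subst]
  congr 1
  funext n
  cases n with
  | zero => rfl
  | succ n =>
    simp only [liftSubst, subst_rename, scons]
    exact subst_var _

theorem subst_scons_etaApp (t v : Term) (s : ℕ → Term) :
    subst (scons v s) (etaApp t) = app (subst s t) v := by
  simp [etaApp, subst, subst_rename, scons]

end Term

/-! ### Reduction -/

open Term

theorem WHStep.betaStep {t u : Term} (h : WHStep t u) : BetaStep t u := by
  induction h with
  | beta u v => exact .beta u v
  | appL u _ ih => exact .appL u ih

theorem WHRed.betaRed {t u : Term} (h : WHRed t u) : BetaRed t u :=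
  Relation.ReflTransGen.mono (fun _ _ => WHStep.betaStep) _ _ h

theorem WHStep.rename {t u : Term} (h : WHStep t u) (r : ℕ → ℕ) :
    WHStep (rename r t) (rename r u) := by
  induction h with
  | beta u v => rw [rename_inst]; exact .beta _ _
  | appL u _ ih => exact .appL _ ih

theorem WHStep.subst {t u : Term} (h : WHStep t u) (s : ℕ → Term) :
    WHStep (subst s t) (subst s u) := by
  induction h with
  | beta u v => rw [subst_inst]; exact .beta _ _
  | appL u _ ih => exact .appL _ ih

theorem WHStep.free {t u : Term} (h : WHStep t u) {x : ℕ} (hx : Free x u) : Free x t := by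
  induction h with
  | beta u v => exact hx.of_inst
  | appL u _ ih => exact hx.imp ih id

theorem WHRed.rename {t u : Term} (h : WHRed t u) (r : ℕ → ℕ) :
    WHRed (rename r t) (rename r u) :=
  Relation.ReflTransGen.lift (Term.rename r) (fun _ _ h => h.rename r) _ _ h

theorem WHRed.subst {t u : Term} (h : WHRed t u) (s : ℕ → Term) :
    WHRed (subst s t) (subst s u) :=
  Relation.ReflTransGen.lift (Term.subst s) (fun _ _ h => h.subst s) _ _ h

theorem WHRed.appL {t t' : Term} (h : WHRed t t') (u : Term) : WHRed (app t u) (app t' u) :=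
  Relation.ReflTransGen.lift (fun t => app t u) (fun _ _ h => h.appL u) _ _ h

theorem WHRed.free {t u : Term} (h : WHRed t u) {x : ℕ} (hx : Free x u) : Free x t := by
  induction h with
  | refl => exact hx
  | tail _ h ih => exact ih (h.free hx)

theorem BetaRed.app {t t' u u' : Term} (h : BetaRed t t') (h' : BetaRed u u') :
    BetaRed (app t u) (app t' u') :=
  (Relation.ReflTransGen.lift (fun t => Term.app t u) (fun _ _ h => h.appL u) _ _ h).trans
    (Relation.ReflTransGen.lift (fun u => Term.app t' u) (fun _ _ h => h.appR t') _ _ h')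

theorem BetaRed.lam {t t' : Term} (h : BetaRed t t') : BetaRed (lam t) (lam t') :=
  Relation.ReflTransGen.lift Term.lam (fun _ _ h => h.lam) _ _ h

theorem BetaStep.rename {t u : Term} (h : BetaStep t u) (r : ℕ → ℕ) :
    BetaStep (rename r t) (rename r u) := by
  induction h generalizing r with
  | beta u v => rw [rename_inst]; exact .beta _ _
  | appL u _ ih => exact .appL _ (ih r)
  | appR t _ ih => exact .appR _ (ih r)
  | lam _ ih => exact .lam (ih _)

theorem BetaRed.etaApp {t u : Term} (h : BetaRed t u) : BetaRed (etaApp t) (etaApp u) :=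
  BetaRed.app (Relation.ReflTransGen.lift (Term.rename Nat.succ) (fun _ _ h => h.rename _) _ _ h) .refl

theorem BetaStep.of_rename {t w : Term} {r : ℕ → ℕ} (h : BetaStep (Term.rename r t) w) :
    ∃ t', BetaStep t t' ∧ w = Term.rename r t' := by
  induction t generalizing r w with
  | var n => cases h
  | app t u iht ihu =>
    generalize e : Term.rename r (.app t u) = z at h
    cases h with
    | beta a b =>
      simp only [Term.rename, Term.app.injEq] at e
      obtain ⟨e, rfl⟩ := e
      cases t with
      | var n => simp [Term.rename] at e
      | app _ _ => simp [Term.rename] at e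
      | lam t =>
        simp only [Term.rename, Term.lam.injEq] at e
        subst e
        exact ⟨_, .beta _ _, (rename_inst _ _ _).symm⟩
    | appL _ h =>
      simp only [Term.rename, Term.app.injEq] at e
      obtain ⟨rfl, rfl⟩ := e
      obtain ⟨t', h', rfl⟩ := iht h
      exact ⟨_, .appL _ h', rfl⟩
    | appR _ h =>
      simp only [Term.rename, Term.app.injEq] at e
      obtain ⟨rfl, rfl⟩ := e
      obtain ⟨t', h', rfl⟩ := ihu h
      exact ⟨_, .appR _ h', rfl⟩
    | lam h => cases e
  | lam t ih =>
    generalize e : Term.rename r (.lam t) = z at h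
    cases h with
    | beta | appL | appR => cases e
    | lam h =>
      simp only [Term.rename, Term.lam.injEq] at e
      subst e
      obtain ⟨t', h', rfl⟩ := ih h
      exact ⟨_, .lam h', rfl⟩

/-- A reduct of `(t) x`, with `x` a new variable, is `(t') x` for a reduct `t'` of `t`, or a reduct
of `r` for a reduct `λ x r` of `t`. -/
theorem BetaRed.of_etaApp {t s : Term} (h : BetaRed (Term.etaApp t) s) :
    (∃ t', BetaRed t t' ∧ s = Term.etaApp t') ∨ ∃ r, BetaRed t (.lam r) ∧ BetaRed r s := by
  induction h with
  | refl => exact Or.inl ⟨t, .refl, rfl⟩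
  | tail _ hs ih =>
    rcases ih with ⟨t', ht, rfl⟩ | ⟨r, ht, hr⟩
    · generalize e : Term.etaApp t' = z at hs
      cases hs with
      | beta a b =>
        simp only [Term.etaApp, Term.app.injEq] at e
        obtain ⟨e, hb⟩ := e
        subst hb
        cases t' with
        | var n => simp [Term.rename] at e
        | app _ _ => simp [Term.rename] at e
        | lam r =>
          simp only [Term.rename, Term.lam.injEq] at e
          subst e
          refine Or.inr ⟨r, ht, ?_⟩
          have : inst (Term.rename (liftRen Nat.succ) r) (.var 0) = r := by
            rw [inst, subst_rename]
            convert subst_var r using 2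
            funext n; cases n <;> rfl
          rw [this]; exact .refl
      | appL _ h =>
        simp only [Term.etaApp, Term.app.injEq] at e
        obtain ⟨rfl, rfl⟩ := e
        obtain ⟨t'', h', rfl⟩ := BetaStep.of_rename h
        exact Or.inl ⟨t'', ht.tail h', rfl⟩
      | appR _ h =>
        simp only [Term.etaApp, Term.app.injEq] at e
        obtain ⟨rfl, rfl⟩ := e
        cases h
      | lam h => cases e
    · exact Or.inr ⟨r, ht, hr.tail hs⟩

/-! ### Standardization -/

/-- Standard reduction: weak head reduction, followed by standard reduction of the immediate
subterms. -/
inductive StdRed : Term → Term → Prop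
  | var {t : Term} {n : ℕ} : WHRed t (.var n) → StdRed t (.var n)
  | app {t a b u v : Term} : WHRed t (.app a b) → StdRed a u → StdRed b v → StdRed t (.app u v)
  | lam {t a u : Term} : WHRed t (.lam a) → StdRed a u → StdRed t (.lam u)

namespace StdRed

theorem refl (t : Term) : StdRed t t := by
  induction t with
  | var n => exact .var .refl
  | app t u iht ihu => exact .app .refl iht ihu
  | lam t ih => exact .lam .refl ih

theorem head {t t' u : Term} (h : WHRed t t') (h' : StdRed t' u) : StdRed t u := by
  cases h' with
  | var h' => exact .var (h.trans h')
  | app h' ha hb => exact .app (h.trans h') ha hb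
  | lam h' ha => exact .lam (h.trans h') ha

theorem rename {t u : Term} (h : StdRed t u) (r : ℕ → ℕ) :
    StdRed (rename r t) (Term.rename r u) := by
  induction h generalizing r with
  | var h => exact .var (h.rename r)
  | app h _ _ iha ihb => exact .app (h.rename r) (iha r) (ihb r)
  | lam h _ ih => exact .lam (h.rename r) (ih _)

theorem subst {t u : Term} (h : StdRed t u) {s s' : ℕ → Term} (hs : ∀ n, StdRed (s n) (s' n)) :
    StdRed (subst s t) (Term.subst s' u) := by
  induction h generalizing s s' with
  | var h => exact head (h.subst s) (hs _)
  | app h _ _ iha ihb => exact .app (h.subst s) (iha hs) (ihb hs)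
  | lam h _ ih =>
    refine .lam (h.subst s) (ih fun n => ?_)
    cases n with
    | zero => exact refl _
    | succ n => exact (hs n).rename _

theorem tail {t u w : Term} (h : StdRed t u) (h' : BetaStep u w) : StdRed t w := by
  induction h' generalizing t with
  | beta u v =>
    cases h with
    | app h ha hb =>
      cases ha with
      | lam ha hc =>
        refine head (h.trans ((ha.appL _).tail (.beta _ _))) (hc.subst fun n => ?_)
        cases n with
        | zero => exact hb
        | succ n => exact refl _
  | appL u _ ih =>
    cases h with
    | app h ha hb => exact .app h (ih ha) hb
  | appR u _ ih =>
    cases h with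
    | app h ha hb => exact .app h ha (ih hb)
  | lam _ ih =>
    cases h with
    | lam h ha => exact .lam h (ih ha)

theorem of_betaRed {t u : Term} (h : BetaRed t u) : StdRed t u := by
  induction h with
  | refl => exact refl t
  | tail _ h ih => exact ih.tail h

theorem betaRed {t u : Term} (h : StdRed t u) : BetaRed t u := by
  induction h with
  | var h => exact h.betaRed
  | app h _ _ iha ihb => exact h.betaRed.trans (iha.app ihb)
  | lam h _ ih => exact h.betaRed.trans ih.lam

end StdRed

/-! ### Renaming and substitution in types -/

namespace Ty

theorem rename_rename (A : Ty) (r r' : ℕ → ℕ) :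
    rename r' (rename r A) = rename (fun n => r' (r n)) A := by
  induction A generalizing r r' with
  | var n => rfl
  | arrow A B ihA ihB => simp [rename, ihA, ihB]
  | all A ih => simp [rename, ih, liftRen_comp]

theorem rename_congr_of_free {A : Ty} {r r' : ℕ → ℕ} (h : ∀ x, Free x A → r x = r' x) :
    rename r A = rename r' A := by
  induction A generalizing r r' with
  | var n => simp [rename, h n rfl]
  | arrow A B ihA ihB =>
    simp only [rename]
    rw [ihA fun x hx => h x (Or.inl hx), ihB fun x hx => h x (Or.inr hx)]
  | all A ih =>
    simp only [rename]
    rw [ih (r' := liftRen r')]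
    intro x hx
    cases x with
    | zero => rfl
    | succ x => simp [liftRen, h x hx]

theorem rename_id (A : Ty) : rename (fun n => n) A = A := by
  induction A with
  | var n => rfl
  | arrow A B ihA ihB => simp [rename, ihA, ihB]
  | all A ih => simp [rename, liftRen_id, ih]

theorem rename_liftRen_shift (A : Ty) (r : ℕ → ℕ) :
    rename (liftRen r) (shift A) = shift (rename r A) := by
  simp [shift, rename_rename, liftRen]

theorem Free.of_rename {A : Ty} {r : ℕ → ℕ} {y : ℕ} (h : Free y (rename r A)) :
    ∃ x, Free x A ∧ y = r x := by
  induction A generalizing r y with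
  | var n => exact ⟨n, rfl, h⟩
  | arrow A B ihA ihB =>
    rcases h with h | h
    · obtain ⟨x, hx, e⟩ := ihA h; exact ⟨x, Or.inl hx, e⟩
    · obtain ⟨x, hx, e⟩ := ihB h; exact ⟨x, Or.inr hx, e⟩
  | all A ih =>
    obtain ⟨x, hx, e⟩ := ih h
    cases x with
    | zero => simp [liftRen] at e
    | succ x => exact ⟨x, hx, by simpa [liftRen] using e⟩

theorem Free.rename {A : Ty} {x : ℕ} (h : Free x A) (r : ℕ → ℕ) : Free (r x) (rename r A) := by
  induction A generalizing x r with
  | var n => exact congrArg r h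
  | arrow A B ihA ihB => exact h.imp (ihA · r) (ihB · r)
  | all A ih => exact ih h (liftRen r)

theorem not_free_zero_shift (A : Ty) : ¬ Free 0 (shift A) := fun h => by
  obtain ⟨x, -, e⟩ := h.of_rename
  exact absurd e (Nat.succ_ne_zero x).symm

theorem exists_free_bound (A : Ty) : ∃ N, ∀ x, Free x A → x < N := by
  induction A with
  | var n => exact ⟨n + 1, fun x h => by obtain rfl : x = n := h; omega⟩
  | arrow A B ihA ihB =>
    obtain ⟨a, ha⟩ := ihA
    obtain ⟨b, hb⟩ := ihB
    refine ⟨max a b, fun x h => ?_⟩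
    rcases h with h | h
    · exact lt_max_of_lt_left (ha x h)
    · exact lt_max_of_lt_right (hb x h)
  | all A ih =>
    obtain ⟨a, ha⟩ := ih
    exact ⟨a, fun x h => by have := ha _ h; omega⟩

/-- An injective numbering of types. -/
def code : Ty → ℕ
  | var n => Nat.pair 0 n
  | arrow A B => Nat.pair 1 (Nat.pair A.code B.code)
  | all A => Nat.pair 2 A.code

theorem code_injective : Function.Injective code := by
  intro A
  induction A with
  | var n => intro B h; cases B <;> simp_all [code, Nat.pair_eq_pair]
  | arrow A A' ih ih' =>
    intro B h
    cases B with
    | arrow B B' =>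
      simp only [code, Nat.pair_eq_pair, true_and] at h
      rw [ih h.1, ih' h.2]
    | _ => simp [code, Nat.pair_eq_pair] at h
  | all A ih =>
    intro B h
    cases B with
    | all B =>
      simp only [code, Nat.pair_eq_pair, true_and] at h
      rw [ih h]
    | _ => simp [code, Nat.pair_eq_pair] at h

instance : Countable Ty := code_injective.countable

instance : Nonempty Ty := ⟨var 0⟩

end Ty

mutual

theorem IsPos.rename : ∀ {A : Ty}, IsPos A → ∀ r, IsPos (A.rename r)
  | _, .var n, r => .var (r n)
  | _, .arrow hB hA, r => .arrow (hB.rename r) (hA.rename r)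
  | .all A, .all hA hf, r => by
    refine .all (hA.rename _) ?_
    exact hf.rename (liftRen r)

theorem IsNeg.rename : ∀ {A : Ty}, IsNeg A → ∀ r, IsNeg (A.rename r)
  | _, .var n, r => .var (r n)
  | _, .arrow hB hA, r => .arrow (hB.rename r) (hA.rename r)

end

/-! ### Values of types -/

theorem Ty.saturated_value (A : Ty) (I : Interp) : Saturated (A.value I) := by
  induction A generalizing I with
  | var n => exact (I n).2
  | arrow A B _ ihB => exact fun t u hu h v hv => ihB I _ _ (hu v hv) (h.appL v)
  | all A ih =>
    intro t u hu h
    simp only [Ty.value, Set.mem_iInter] at hu ⊢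
    exact fun G => ih _ t u (hu G) h

theorem Ty.value_rename (A : Ty) (r : ℕ → ℕ) (I : Interp) :
    (A.rename r).value I = A.value (fun n => I (r n)) := by
  induction A generalizing r I with
  | var n => rfl
  | arrow A B ihA ihB => simp [Ty.rename, Ty.value, ihA, ihB]
  | all A ih =>
    simp only [Ty.rename, Ty.value, ih]
    refine Set.iInter_congr fun G => ?_
    congr 1
    funext n; cases n <;> rfl

theorem Ty.value_shift (A : Ty) (I : Interp) (G : {G : Set Term // Saturated G}) :
    A.shift.value (I.push G) = A.value I :=
  A.value_rename _ _

theorem Ty.value_subst (A : Ty) (s : ℕ → Ty) (I : Interp) :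
    (A.subst s).value I = A.value (fun n => ⟨(s n).value I, (s n).saturated_value I⟩) := by
  induction A generalizing s I with
  | var n => rfl
  | arrow A B ihA ihB => simp [Ty.subst, Ty.value, ihA, ihB]
  | all A ih =>
    simp only [Ty.subst, Ty.value, ih]
    refine Set.iInter_congr fun G => ?_
    congr 1
    funext n
    cases n with
    | zero => rfl
    | succ n => exact Subtype.ext ((s n).value_shift I G)

theorem HasType.subst_mem_value {Γ : List Ty} {t : Term} {A : Ty} (h : HasType Γ t A)
    (I : Interp) (s : ℕ → Term) (hs : ∀ i B, Γ[i]? = some B → s i ∈ B.value I) :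
    t.subst s ∈ A.value I := by
  induction h generalizing I s with
  | var h => exact hs _ _ h
  | @lam Γ t B C _ ih =>
    intro v hv
    refine C.saturated_value I _ _ (ih I (scons v s) ?_) (.single ?_)
    · intro i D hi
      cases i with
      | zero => simp only [List.getElem?_cons_zero, Option.some.injEq] at hi; subst hi; exact hv
      | succ i => exact hs i D (by simpa using hi)
    · rw [← inst_subst_liftSubst]
      exact .beta _ _
  | app _ _ ihu ihv => exact ihu I s hs _ (ihv I s hs)
  | gen _ ih =>
    simp only [Ty.value, Set.mem_iInter]
    refine fun G => ih _ s fun i B hi => ?_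
    simp only [List.getElem?_map, Option.map_eq_some_iff] at hi
    obtain ⟨B, hB, rfl⟩ := hi
    rw [Ty.value_shift]
    exact hs i B hB
  | @inst Γ t A C _ ih =>
    have := ih I s hs
    simp only [Ty.value, Set.mem_iInter] at this
    have := this ⟨C.value I, C.saturated_value I⟩
    rw [Ty.inst, Ty.value_subst]
    convert this using 2
    funext n; cases n <;> rfl

theorem HasType.mem_sem {t : Term} {A : Ty} (h : HasType [] t A) : t ∈ A.sem := by
  simp only [Ty.sem, Set.mem_iInter]
  intro I
  have := h.subst_mem_value I .var (by simp)
  rwa [Term.subst_var] at this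

/-! ### Long head normal form derivations -/

/-- Partial assignments of types to term variables. -/
abbrev Ctx : Type := ℕ → Option Ty

namespace Ctx

/-- A context extended by a declaration for a new variable `0`. -/
def cons (B : Ty) (Γ : Ctx) : Ctx
  | 0 => some B
  | n + 1 => Γ n

/-- The same context, read in a scope with a new type variable `0`. -/
def shift (Γ : Ctx) : Ctx := fun n => (Γ n).map Ty.shift

/-- All declared types are negative. -/
def Neg (Γ : Ctx) : Prop := ∀ x B, Γ x = some B → IsNeg B

theorem Neg.cons {Γ : Ctx} (h : Γ.Neg) {B : Ty} (hB : IsNeg B) : (Γ.cons B).Neg := by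
  intro x C hC
  cases x with
  | zero => obtain rfl : B = C := Option.some.inj hC; exact hB
  | succ x => exact h x C hC

theorem Neg.shift {Γ : Ctx} (h : Γ.Neg) : Γ.shift.Neg := by
  intro x C hC
  simp only [Ctx.shift, Option.map_eq_some_iff] at hC
  obtain ⟨B, hB, rfl⟩ := hC
  exact (h x B hB).rename _

end Ctx

mutual

/-- `LongType Γ t A`: the term `t`, applied to new variables until its type is atomic, has a head
normal form whose head variable is declared in `Γ` and whose arguments are of the same kind. -/
inductive LongType : Ctx → Term → Ty → Prop
  | var {Γ : Ctx} {t u : Term} {n : ℕ} :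
      WHRed t u → LongNe Γ u (.var n) → LongType Γ t (.var n)
  | arrow {Γ : Ctx} {t : Term} {B A : Ty} :
      LongType (Γ.cons B) (etaApp t) A → LongType Γ t (.arrow B A)
  | all {Γ : Ctx} {t : Term} {A : Ty} :
      LongType Γ.shift t A → LongType Γ t (.all A)

/-- A declared variable applied to arguments that are typed by `LongType`. -/
inductive LongNe : Ctx → Term → Ty → Prop
  | var {Γ : Ctx} {x : ℕ} {A : Ty} : Γ x = some A → LongNe Γ (.var x) A
  | app {Γ : Ctx} {u v : Term} {B A : Ty} :
      LongNe Γ u (.arrow B A) → LongType Γ v B → LongNe Γ (.app u v) A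

end

mutual

theorem LongType.rename : ∀ {Γ : Ctx} {t : Term} {A : Ty}, LongType Γ t A →
    ∀ (r q : ℕ → ℕ) (Γ' : Ctx), (∀ x, t.Free x → Γ' (r x) = (Γ x).map (Ty.rename q)) →
    LongType Γ' (t.rename r) (A.rename q)
  | _, _, _, .var hw hu, r, q, Γ', hΓ =>
    .var (hw.rename r) (hu.rename r q Γ' fun x hx => hΓ x (hw.free hx))
  | _, t, _, .arrow h, r, q, Γ', hΓ => by
    refine .arrow ?_
    rw [← rename_etaApp]
    refine h.rename (liftRen r) q _ fun x hx => ?_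
    rcases hx.of_etaApp with rfl | ⟨x, rfl, hx'⟩
    · rfl
    · exact hΓ x hx'
  | Γ, _, _, .all h, r, q, Γ', hΓ => by
    refine .all (h.rename r (liftRen q) _ fun x hx => ?_)
    simp only [Ctx.shift, hΓ x hx, Option.map_map]
    congr 1
    funext B
    exact (Ty.rename_liftRen_shift B q).symm

theorem LongNe.rename : ∀ {Γ : Ctx} {t : Term} {A : Ty}, LongNe Γ t A →
    ∀ (r q : ℕ → ℕ) (Γ' : Ctx), (∀ x, t.Free x → Γ' (r x) = (Γ x).map (Ty.rename q)) →
    LongNe Γ' (t.rename r) (A.rename q)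
  | _, _, _, .var h, r, q, Γ', hΓ => .var (by rw [hΓ _ rfl, h]; rfl)
  | _, _, _, .app hu hv, r, q, Γ', hΓ =>
    .app (hu.rename r q Γ' fun x hx => hΓ x (Or.inl hx))
      (hv.rename r q Γ' fun x hx => hΓ x (Or.inr hx))

end

mutual

theorem LongType.subst_mem_value : ∀ {Γ : Ctx} {t : Term} {A : Ty}, LongType Γ t A →
    ∀ (I : Interp) (s : ℕ → Term), (∀ x B, Γ x = some B → s x ∈ B.value I) →
    t.subst s ∈ A.value I
  | _, _, .var n, .var hw hu, I, s, hs =>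
    (I n).2 _ _ (hu.subst_mem_value I s hs) (hw.subst s)
  | _, t, .arrow B A, .arrow h, I, s, hs => by
    intro v hv
    rw [← subst_scons_etaApp]
    refine h.subst_mem_value I _ fun x C hx => ?_
    cases x with
    | zero => obtain rfl : B = C := Option.some.inj hx; exact hv
    | succ x => exact hs x C hx
  | _, _, .all A, .all h, I, s, hs => by
    simp only [Ty.value, Set.mem_iInter]
    refine fun G => h.subst_mem_value _ s fun x C hx => ?_
    simp only [Ctx.shift, Option.map_eq_some_iff] at hx
    obtain ⟨B, hB, rfl⟩ := hx
    rw [Ty.value_shift]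
    exact hs x B hB

theorem LongNe.subst_mem_value : ∀ {Γ : Ctx} {t : Term} {A : Ty}, LongNe Γ t A →
    ∀ (I : Interp) (s : ℕ → Term), (∀ x B, Γ x = some B → s x ∈ B.value I) →
    t.subst s ∈ A.value I
  | _, _, _, .var h, _, _, hs => hs _ _ h
  | _, _, _, .app hu hv, I, s, hs => hu.subst_mem_value I s hs _ (hv.subst_mem_value I s hs)

end

theorem LongType.mem_sem {t : Term} {A : Ty} (h : LongType (fun _ => none) t A) : t ∈ A.sem := by
  simp only [Ty.sem, Set.mem_iInter]
  intro I
  have := h.subst_mem_value I .var (by simp)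
  rwa [Term.subst_var] at this

mutual

theorem LongType.of_betaRed : ∀ {Γ : Ctx} {u : Term} {A : Ty}, LongType Γ u A →
    ∀ {t : Term}, BetaRed t u → LongType Γ t A
  | _, _, _, .var hw hu, t, h => by
    obtain ⟨t', ht, ht'⟩ := hu.exists_of_betaRed (h.trans hw.betaRed)
    exact .var ht ht'
  | _, _, _, .arrow hu, t, h => .arrow (hu.of_betaRed h.etaApp)
  | _, _, _, .all hu, t, h => .all (hu.of_betaRed h)

theorem LongNe.exists_of_betaRed : ∀ {Γ : Ctx} {u : Term} {A : Ty}, LongNe Γ u A →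
    ∀ {t : Term}, BetaRed t u → ∃ t', WHRed t t' ∧ LongNe Γ t' A
  | _, _, _, .var hx, t, h => by
    cases StdRed.of_betaRed h with
    | var h => exact ⟨_, h, .var hx⟩
  | _, _, _, .app hu hv, t, h => by
    cases StdRed.of_betaRed h with
    | app h ha hb =>
      obtain ⟨a', ha', hn⟩ := hu.exists_of_betaRed ha.betaRed
      exact ⟨_, h.trans (ha'.appL _), .app hn (hv.of_betaRed hb.betaRed)⟩

end

/-! ### Completeness of long head normal form derivations -/

/-- The value of the type variable `n` in the term model over `Γ`. -/
def Ctx.interp (Γ : Ctx) : Interp := fun n =>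
  ⟨{t | LongType Γ t (.var n)}, fun _ _ hu h => hu.of_betaRed h.betaRed⟩

theorem exists_ctx (N : ℕ) : ∃ Γ : Ctx, (∀ x < N, Γ x = none) ∧
    ∀ B M, ∃ y, M ≤ y ∧ Γ y = some B := by
  obtain ⟨e, he⟩ := exists_surjective_nat Ty
  refine ⟨fun x => if x < N then none else some (e (Nat.unpair (x - N)).1), ?_, ?_⟩
  · intro x hx; simp [hx]
  · intro B M
    obtain ⟨a, rfl⟩ := he B
    refine ⟨N + Nat.pair a M, (Nat.right_le_pair a M).trans (Nat.le_add_left _ _), ?_⟩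
    simp

theorem exists_fresh_tyVar (Γ : Ctx) (N : ℕ) :
    ∃ M, ∀ x < N, ∀ B, Γ x = some B → ∀ y, B.Free y → y < M := by
  induction N with
  | zero => exact ⟨0, by simp⟩
  | succ N ih =>
    obtain ⟨M, hM⟩ := ih
    obtain ⟨M', hM'⟩ : ∃ M', ∀ B, Γ N = some B → ∀ y, B.Free y → y < M' := by
      cases h : Γ N with
      | none => exact ⟨0, by simp⟩
      | some B =>
        obtain ⟨a, ha⟩ := B.exists_free_bound
        exact ⟨a, by rintro _ ⟨⟩; exact ha⟩
    refine ⟨max M M', fun x hx B hB y hy => ?_⟩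
    rcases Nat.lt_succ_iff_lt_or_eq.1 hx with hx | rfl
    · exact lt_max_of_lt_left (hM x hx B hB y hy)
    · exact lt_max_of_lt_right (hM' B hB y hy)

theorem longType_arrow_of_fresh {Γ : Ctx} {t : Term} {B A : Ty} {y : ℕ} (hy : Γ y = some B)
    (hf : ∀ x, t.Free x → x < y) (h : LongType Γ (.app t (.var y)) A) :
    LongType Γ t (.arrow B A) := by
  have := h.rename (fun x => if x = y then 0 else x + 1) (fun n => n) (Γ.cons B) ?_
  · rw [Ty.rename_id, Term.rename] at this
    refine .arrow ?_
    convert this using 1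
    simp only [etaApp, Term.rename, if_true]
    congr 1
    refine Term.rename_congr_of_free fun x hx => ?_
    rw [if_neg (hf x hx).ne]
  · have hid : Ty.rename (fun n => n) = id := funext Ty.rename_id
    rw [hid]
    rintro x (hx | rfl)
    · simp [(hf x hx).ne, Ctx.cons]
    · simp [Ctx.cons, hy]

mutual

theorem IsPos.longType_of_mem_value {Γ : Ctx} (hΓ : ∀ B M, ∃ y, M ≤ y ∧ Γ y = some B) :
    ∀ {A : Ty}, IsPos A → ∀ (r : ℕ → ℕ) (t : Term),
    t ∈ A.value (fun n => Γ.interp (r n)) → LongType Γ t (A.rename r)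
  | _, .var _, _, _, ht => ht
  | .arrow B A, .arrow hB hA, r, t, ht => by
    obtain ⟨N, hN⟩ := t.exists_free_bound
    obtain ⟨y, hy, hyB⟩ := hΓ (B.rename r) N
    exact longType_arrow_of_fresh hyB (fun x hx => (hN x hx).trans_le hy)
      (hA.longType_of_mem_value hΓ r _ (ht _ (hB.mem_value hΓ r _ (.var hyB))))
  | .all A, .all hA _, r, t, ht => by
    obtain ⟨N, hN⟩ := t.exists_free_bound
    obtain ⟨M, hM⟩ := exists_fresh_tyVar Γ N
    obtain ⟨K, hK⟩ := ((Ty.all A).rename r).exists_free_bound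
    have hlt : ∀ x, (Ty.all A).Free x → r x < max M K := fun x hx =>
      lt_max_of_lt_right (hK _ (hx.rename r))
    let r' : ℕ → ℕ := fun n => n.casesOn (max M K) r
    have h := hA.longType_of_mem_value hΓ r' t (by
      simp only [Ty.value, Set.mem_iInter] at ht
      convert ht (Γ.interp (max M K)) using 2
      funext n; cases n <;> rfl)
    have := h.rename (fun x => x) (fun n => if n = max M K then 0 else n + 1) Γ.shift ?_
    · rw [Term.rename_id, Ty.rename_rename] at this
      refine .all ?_
      convert this using 1
      refine Ty.rename_congr_of_free fun x hx => ?_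
      cases x with
      | zero => simp [r', liftRen]
      | succ x => simp [r', liftRen, (hlt x hx).ne]
    · intro x hx
      simp only [Ctx.shift]
      cases hB : Γ x with
      | none => rfl
      | some B =>
        simp only [Option.map_some, Option.some.injEq]
        refine Ty.rename_congr_of_free fun y hy => ?_
        rw [if_neg ((hM x (hN x hx) B hB y hy).trans_le (le_max_left _ _)).ne]

theorem IsNeg.mem_value {Γ : Ctx} (hΓ : ∀ B M, ∃ y, M ≤ y ∧ Γ y = some B) :
    ∀ {A : Ty}, IsNeg A → ∀ (r : ℕ → ℕ) (t : Term),
    LongNe Γ t (A.rename r) → t ∈ A.value (fun n => Γ.interp (r n))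
  | _, .var _, _, _, ht => .var .refl ht
  | .arrow _ _, .arrow hB hA, r, _, ht => fun u hu =>
    hA.mem_value hΓ r _ (.app ht (hB.longType_of_mem_value hΓ r u hu))

end

theorem IsPos.longType_of_mem_sem {A : Ty} (hA : IsPos A) {t : Term} (ht : t ∈ A.sem) :
    LongType (fun _ => none) t A := by
  obtain ⟨N, hN⟩ := t.exists_free_bound
  obtain ⟨Γ, hΓ, hΓ'⟩ := exists_ctx N
  have h := hA.longType_of_mem_value hΓ' (fun n => n) t (Set.mem_iInter.1 ht Γ.interp)
  have := h.rename (fun x => x) (fun n => n) (fun _ => none) fun x hx => by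
    rw [hΓ x (hN x hx)]; rfl
  rwa [Term.rename_id, Ty.rename_id, Ty.rename_id] at this

/-! ### Typable normal forms -/

mutual

/-- Typing of normal forms by the rules for declared variables, applications, abstractions and
quantification. -/
inductive NfType : Ctx → Term → Ty → Prop
  | ne {Γ : Ctx} {t : Term} {A : Ty} : NeType Γ t A → NfType Γ t A
  | lam {Γ : Ctx} {t : Term} {B A : Ty} : NfType (Γ.cons B) t A → NfType Γ (.lam t) (.arrow B A)
  | all {Γ : Ctx} {t : Term} {A : Ty} : NfType Γ.shift t A → NfType Γ t (.all A)

/-- Typing of a variable applied to normal forms. -/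
inductive NeType : Ctx → Term → Ty → Prop
  | var {Γ : Ctx} {x : ℕ} {A : Ty} : Γ x = some A → NeType Γ (.var x) A
  | app {Γ : Ctx} {u v : Term} {B A : Ty} :
      NeType Γ u (.arrow B A) → NfType Γ v B → NeType Γ (.app u v) A

end

mutual

theorem NfType.hasType : ∀ {Γ : Ctx} {t : Term} {A : Ty}, NfType Γ t A →
    ∀ L : List Ty, (∀ i, Γ i = L[i]?) → HasType L t A
  | _, _, _, .ne h, L, hL => h.hasType L hL
  | _, _, _, .lam h, L, hL => .lam (h.hasType _ fun i => by
      cases i with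
      | zero => rfl
      | succ i => exact (hL i).trans (by simp))
  | _, _, _, .all h, L, hL => .gen (h.hasType _ fun i => by simp [Ctx.shift, hL i])

theorem NeType.hasType : ∀ {Γ : Ctx} {t : Term} {A : Ty}, NeType Γ t A →
    ∀ L : List Ty, (∀ i, Γ i = L[i]?) → HasType L t A
  | _, _, _, .var h, L, hL => .var (by rw [← hL, h])
  | _, _, _, .app hu hv, L, hL => .app (hu.hasType L hL) (hv.hasType L hL)

end

mutual

theorem NfType.rename : ∀ {Γ : Ctx} {t : Term} {A : Ty}, NfType Γ t A →
    ∀ (r : ℕ → ℕ) (Γ' : Ctx), (∀ x, t.Free x → Γ' (r x) = Γ x) → NfType Γ' (t.rename r) A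
  | _, _, _, .ne h, r, Γ', hΓ => .ne (h.rename r Γ' hΓ)
  | _, _, _, .lam h, r, Γ', hΓ => .lam (h.rename (liftRen r) _ fun x hx => by
      cases x with
      | zero => rfl
      | succ x => exact hΓ x hx)
  | _, _, _, .all h, r, Γ', hΓ => .all (h.rename r _ fun x hx => by simp [Ctx.shift, hΓ x hx])

theorem NeType.rename : ∀ {Γ : Ctx} {t : Term} {A : Ty}, NeType Γ t A →
    ∀ (r : ℕ → ℕ) (Γ' : Ctx), (∀ x, t.Free x → Γ' (r x) = Γ x) → NeType Γ' (t.rename r) A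
  | _, _, _, .var h, r, Γ', hΓ => .var (by rw [hΓ _ rfl, h])
  | _, _, _, .app hu hv, r, Γ', hΓ =>
    .app (hu.rename r Γ' fun x hx => hΓ x (Or.inl hx)) (hv.rename r Γ' fun x hx => hΓ x (Or.inr hx))

end

theorem NeType.of_cons {Γ : Ctx} {t : Term} {A B : Ty}
    (h : NeType (Γ.cons B) (t.rename Nat.succ) A) : NeType Γ t A := by
  have := h.rename Nat.pred Γ fun x hx => by
    obtain ⟨x, -, rfl⟩ := hx.of_rename
    rfl
  rwa [Term.rename_rename, show (fun n => Nat.pred (Nat.succ n)) = fun n => n from rfl,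
    Term.rename_id] at this

/-- A property of types that holds of the declared types and passes from `B → A` to `A` holds of
the types of neutral terms. -/
theorem NeType.type_induction {P : Ty → Prop} (hP : ∀ B A, P (.arrow B A) → P A) :
    ∀ {Γ : Ctx} {t : Term} {A : Ty}, NeType Γ t A → (∀ x B, Γ x = some B → P B) → P A
  | _, _, _, .var h, hΓ => hΓ _ _ h
  | _, _, _, .app hu _, hΓ => hP _ _ (hu.type_induction hP hΓ)

theorem NeType.isNeg {Γ : Ctx} {t : Term} {A : Ty} (h : NeType Γ t A) (hΓ : Γ.Neg) : IsNeg A :=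
  h.type_induction (P := IsNeg) (fun _ _ h => by cases h; assumption) hΓ

/-- A normal form of positive type that is not an abstraction is typed without quantification. -/
theorem NfType.neType {t : Term} (ht : ∀ u, t ≠ .lam u) : ∀ {Γ : Ctx} {A : Ty},
    NfType Γ t A → IsPos A → NeType Γ t A
  | _, _, .ne h, _ => h
  | _, _, .lam _, _ => absurd rfl (ht _)
  | Γ, .all A, .all h, .all hA hf => by
    refine absurd hf ((h.neType ht hA).type_induction (P := fun A => ¬ A.Free 0)
      (fun _ _ h h' => h (Or.inr h')) fun x B hB => ?_)
    simp only [Ctx.shift, Option.map_eq_some_iff] at hB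
    obtain ⟨C, -, rfl⟩ := hB
    exact C.not_free_zero_shift

theorem NfType.eta {Γ : Ctx} (hΓ : Γ.Neg) {t : Term} {B A : Ty} (hB : IsNeg B) (hA : IsPos A)
    (h : NfType (Γ.cons B) (etaApp t) A) : NfType Γ t (.arrow B A) := by
  cases h.neType (by simp [etaApp]) hA with
  | app hu hv =>
    have hneg := hu.isNeg (hΓ.cons hB)
    cases hneg with
    | arrow hC _ =>
      cases hv.neType (by simp) hC with
      | var e =>
        obtain rfl := Option.some.inj e
        exact .ne hu.of_cons

mutual

theorem LongType.exists_nfType : ∀ {Γ : Ctx} {t : Term} {A : Ty}, LongType Γ t A → Γ.Neg →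
    IsPos A → ∃ t', BetaRed t t' ∧ NfType Γ t' A
  | _, _, _, .var hw hu, hΓ, _ => by
    obtain ⟨u', hu', h⟩ := hu.exists_neType hΓ
    exact ⟨u', hw.betaRed.trans hu', .ne h⟩
  | _, _, _, .arrow h, hΓ, .arrow hB hA => by
    obtain ⟨s, hs, h'⟩ := h.exists_nfType (hΓ.cons hB) hA
    rcases hs.of_etaApp with ⟨t', ht, rfl⟩ | ⟨r, ht, hr⟩
    · exact ⟨t', ht, h'.eta hΓ hB hA⟩
    · exact ⟨_, ht.trans hr.lam, .lam h'⟩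
  | _, _, _, .all h, hΓ, .all hA _ => by
    obtain ⟨t', ht, h'⟩ := h.exists_nfType hΓ.shift hA
    exact ⟨t', ht, .all h'⟩

theorem LongNe.exists_neType : ∀ {Γ : Ctx} {t : Term} {A : Ty}, LongNe Γ t A → Γ.Neg →
    ∃ t', BetaRed t t' ∧ NeType Γ t' A
  | _, _, _, .var h, _ => ⟨_, .refl, .var h⟩
  | _, _, _, .app hu hv, hΓ => by
    obtain ⟨u', hu', h⟩ := hu.exists_neType hΓ
    cases h.isNeg hΓ with
    | arrow hB _ =>
      obtain ⟨v', hv', h'⟩ := hv.exists_nfType hΓ hB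
      exact ⟨_, hu'.app hv', .app h h'⟩

end

end SystemF

open SystemF in
theorem mainTheorem1 (A : SystemF.Ty) (hA : SystemF.IsPos A) (t : SystemF.Term) :
    t ∈ A.sem ↔ ∃ t' : SystemF.Term, SystemF.BetaRed t t' ∧ SystemF.HasType [] t' A := by
  constructor
  · intro ht
    obtain ⟨t', h, h'⟩ := (hA.longType_of_mem_sem ht).exists_nfType (by simp [Ctx.Neg]) hA
    exact ⟨t', h, h'.hasType [] (by simp)⟩
  · rintro ⟨t', h, h'⟩
    exact ((hA.longType_of_mem_sem h'.mem_sem).of_betaRed h).mem_sem
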